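/- **Setting.** Fix integers $n,m\ge 0$ and reals $q>0$, $\alpha\ge 0$. An online node is a pair $(N,q')$ with $\emptyset\ne N\subseteq[n]$ and $q'>0$; its feasible allocations are $\Delta(N,q')=\{x\in\mathbb{R}_{\ge0}^n : x(i)=0 \text{ for } i\notin N,\ \sum_i x(i)=q'\}$. For a request sequence $E=((N_t,q_t))_{t\in[m]}$ let $\Delta(E)=\sum_t\Delta(N_t,q_t)$ (Minkowski sum) be the set of feasible load vectors. For $x,y\in\mathbb{R}_{\ge 0}^n$, $x$ *majorizes* $y$ ($x\succeq y$) if $\sum_i x(i)=\sum_i y(i)$ and, for every $j\le n$, the sum of the $j$ largest entries of $x$ is at least that of $y$. A function $f:\mathbb{R}_{\ge0}^n\to\mathbb{R}_{\ge0}$ is *Schur-concave* if $x\preceq y$ implies $f(x)\ge f(y)$; $g:\mathbb{R}_{\ge0}^n\to\mathbb{R}_{\ge0}$ is *Schur-convex* if $x\preceq y$ implies $g(x)\le g(y)$. $\mathrm{OPT}(E)$ denotes the majorization-minimal element of $\Delta(E)$. A (possibly randomized) *policy* $\mathcal A$ maps, given its random coin flips, the history of past online nodes and allocations and the current online node to a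 feasible allocation of that node. An *adaptive request sequence* $E\in\mathcal{E}_{n,m,q}$ is a map from the history of past online nodes and allocations to the next online node such that, whatever feasible allocations are made, the $m$ generated online nodes have total quantity $q$. (All these maps are measurable.) Playing $\mathcal A$ against $E$ generates a random request sequence $((N_t,q_t))_{t\in[m]}$ and allocations $(x_t)_{t\in[m]}$; put $\mathcal A(E)=\sum_t x_t$ and let $\mathrm{OPT}(\mathcal A,E)$ be the hindsight optimum $\mathrm{OPT}$ of the generated sequence. The $\alpha$-regrets against an adaptive adversary are $$\mathrm{Reg}^{\max}_{(n,m,q),\alpha,f}(\mathcal A)=\sup_{\text{adaptive }E\in\mathcal{E}_{n,m,q}}\mathbb{E}\big[\alpha f(\mathrm{OPT}(\mathcal A,E))-f(\mathcal A(E))\big],$$ $$\mathrm{Reg}^{\min}_{(n,m,q),\alpha,g}(\mathcal A)=\sup_{\text{adaptive }E\in\mathcal{E}_{n,m,q}}\mathbb{E}\big[g(\mathcal A(E))-\alpha g(\mathrm{OPT}(\mathcal A,E))\big].$$ *Water-filling* $\mathrm{WF}$ is the deterministic policy that, at the arrival of $(N_t,q_t)$ with current load vector $\ell_{t-1}=\sum_{s<t}x_s$,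 plays the solution $x_t$ of $\max\ \min_{i\in N_t}\{x_t(i)+\ell_{t-1}(i)\}$ subject to $x_t\in\Delta(N_t,q_t)$. **Corollary (Adaptive Minimax Optimality).** Let $\mathcal A$ be any (possibly randomized) policy. 1. For every Schur-concave $f:\mathbb{R}_{\ge0}^n\to\mathbb{R}_{\ge0}$ for which the expectations in the $\alpha$-regret of $\mathcal A$ are defined, $\ \mathrm{Reg}^{\max}_{(n,m,q),\alpha,f}(\mathrm{WF})\le \mathrm{Reg}^{\max}_{(n,m,q),\alpha,f}(\mathcal A)$. 2. For every Schur-convex $g:\mathbb{R}_{\ge0}^n\to\mathbb{R}_{\ge0}$ for which the expectations in the $\alpha$-regret of $\mathcal A$ are defined, $\ \mathrm{Reg}^{\min}_{(n,m,q),\alpha,g}(\mathrm{WF})\le \mathrm{Reg}^{\min}_{(n,m,q),\alpha,g}(\mathcal A)$. (The random variables involved are bounded, so the expectations are defined as soon as these are measurable, in particular whenever the objective is Borel measurable or $\mathcal A$ is deterministic.) -/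

import Mathlib

open MeasureTheory
open scoped NNReal BigOperators

universe u

namespace WaterFilling

/-! ### Online nodes, allocations, load vectors -/

/-- Vectors in `ℝ_{≥0}^n`: allocations and load vectors on the `n` offline nodes. -/
abbrev Vec (n : ℕ) : Type := Fin n → ℝ≥0

/-- An online node `(N, q)`: its neighbourhood `N ⊆ [n]` and its quantity `q`. -/
abbrev Node (n : ℕ) : Type := Finset (Fin n) × ℝ≥0

/-- One round of the game: the online node that arrived and the allocation chosen for it. -/
abbrev Round (n : ℕ) : Type := Node n × Vec n

/-- The set `Δ(N, q)` of feasible allocations of an online node: compatibility and full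
distribution. -/
def feasibleAllocations {n : ℕ} (ν : Node n) : Set (Vec n) :=
  {x | (∀ i, i ∉ ν.1 → x i = 0) ∧ ∑ i, x i = ν.2}

/-- The set `Δ(E)` of feasible load vectors of a static request sequence `E` with `m` online
nodes: the Minkowski sum of the sets `Δ(N_t, q_t)`. -/
def feasibleLoads {n m : ℕ} (E : Fin m → Node n) : Set (Vec n) :=
  {l | ∃ x : Fin m → Vec n, (∀ t, x t ∈ feasibleAllocations (E t)) ∧ l = ∑ t, x t}

/-! ### Majorization and Schur-monotone functions -/

/-- The decreasing rearrangement `x↓` of `x`. -/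
noncomputable def decreasing {n : ℕ} (x : Vec n) : Vec n :=
  fun i => x (Tuple.sort x (Fin.rev i))

/-- `Majorizes x y` means `x ⪰ y`: equal totals, and the sum of the `j` largest entries of `x`
is at least the sum of the `j` largest entries of `y`, for every `j ≤ n`. -/
def Majorizes {n : ℕ} (x y : Vec n) : Prop :=
  ∑ i, x i = ∑ i, y i ∧
    ∀ j ≤ n, ∑ i with (i : Fin n).val < j, decreasing y i
      ≤ ∑ i with (i : Fin n).val < j, decreasing x i

/-- `f` reverses the majorization order. -/
def SchurConcave {n : ℕ} (f : Vec n → ℝ≥0) : Prop :=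
  ∀ x y, Majorizes y x → f y ≤ f x

/-- `g` preserves the majorization order. -/
def SchurConvex {n : ℕ} (g : Vec n → ℝ≥0) : Prop :=
  ∀ x y, Majorizes y x → g x ≤ g y

/-- `l` is a majorization-minimal element of `Δ(E)`: every feasible load vector majorizes it. -/
def IsHindsightOptimal {n m : ℕ} (E : Fin m → Node n) (l : Vec n) : Prop :=
  l ∈ feasibleLoads E ∧ ∀ l' ∈ feasibleLoads E, Majorizes l' l

open Classical in
/-- The hindsight optimum `OPT(E)`: the majorization-minimal feasible load vector of `E`. (It
exists, and is unique, whenever all neighbourhoods of `E` are non-empty.) -/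
noncomputable def OPT {n m : ℕ} (E : Fin m → Node n) : Vec n :=
  if h : ∃ l, IsHindsightOptimal E l then h.choose else 0

/-! ### Policies -/

/-- A (possibly randomized) allocation policy: a probability space of coin flips and, for each
outcome `ω`, a map from the history of arrivals and decisions and the current online node to a
feasible allocation of that node. History of the first `t` rounds: a map `Fin t → Round n`.
A deterministic policy is one whose map does not depend on `ω`. -/
structure Policy (n : ℕ) : Type (u + 1) where
  /-- outcomes of the coin flips -/
  Ω : Type u
  [measurableSpace : MeasurableSpace Ω]
  /-- law of the coin flips -/
  P : Measure Ω
  [isProbabilityMeasure : IsProbabilityMeasure P]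
  /-- the allocation chosen for the current node -/
  act : Ω → (t : ℕ) → (Fin t → Round n) → Node n → Vec n
  act_feasible : ∀ ω t h (ν : Node n), ν.1.Nonempty → act ω t h ν ∈ feasibleAllocations ν
  measurable_act : ∀ t, Measurable fun p : Ω × (Fin t → Round n) × Node n =>
    act p.1 t p.2.1 p.2.2

attribute [instance] Policy.measurableSpace Policy.isProbabilityMeasure

/-! ### Adaptive adversaries -/

/-- `h` is a possible history of `t` rounds when the adversary uses the map `next`: each online
node is the one dictated by the preceding rounds, and each allocation is feasible. -/
def IsHistory {n : ℕ} (next : (t : ℕ) → (Fin t → Round n) → Node n) (t : ℕ)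
    (h : Fin t → Round n) : Prop :=
  ∀ s : Fin t, (h s).1 = next s (fun r => h (Fin.castLE s.isLt.le r)) ∧
    (h s).2 ∈ feasibleAllocations (h s).1

/-- An adaptive request sequence in `ℰ_{n,m,q}`: a map from the history of past online nodes and
allocations to the next online node, such that, whatever feasible allocations are made, the
`m` online nodes have non-empty neighbourhoods, positive quantities, and total quantity `q`. -/
structure AdaptiveSequence (n m : ℕ) (q : ℝ≥0) where
  /-- the next online node, given the history -/
  next : (t : ℕ) → (Fin t → Round n) → Node n
  measurable_next : ∀ t, Measurable (next t)
  neighbourhood_nonempty : ∀ t < m, ∀ h, IsHistory next t h → (next t h).1.Nonempty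
  quantity_pos : ∀ t < m, ∀ h, IsHistory next t h → 0 < (next t h).2
  total_quantity : ∀ h, IsHistory next m h → ∑ t, (h t).1.2 = q

/-! ### The game -/

section Game

variable {n m : ℕ} {q : ℝ≥0}

/-- The first `t` rounds of the game of the policy `A`, with coin flips `ω`, against `E`. -/
def play (A : Policy n) (E : AdaptiveSequence n m q) (ω : A.Ω) : (t : ℕ) → Fin t → Round n
  | 0 => Fin.elim0
  | t + 1 =>
    let h := play A E ω t
    let ν := E.next t h
    Fin.snoc h (ν, A.act ω t h ν)

/-- The static request sequence `((N_t, q_t))_{t ∈ [m]}` generated in the game. -/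
def requests (A : Policy n) (E : AdaptiveSequence n m q) (ω : A.Ω) : Fin m → Node n :=
  fun t => (play A E ω m t).1

/-- The load vector `A(E) = ∑_t x_t` generated in the game. -/
def load (A : Policy n) (E : AdaptiveSequence n m q) (ω : A.Ω) : Vec n :=
  ∑ t, (play A E ω m t).2

/-- `α · f(OPT(A, E)) - f(A(E))`, as a function of the coin flips. -/
noncomputable def lossMax (α : ℝ) (f : Vec n → ℝ≥0) (A : Policy n)
    (E : AdaptiveSequence n m q) (ω : A.Ω) : ℝ :=
  α * f (OPT (requests A E ω)) - f (load A E ω)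

/-- `g(A(E)) - α · g(OPT(A, E))`, as a function of the coin flips. -/
noncomputable def lossMin (α : ℝ) (g : Vec n → ℝ≥0) (A : Policy n)
    (E : AdaptiveSequence n m q) (ω : A.Ω) : ℝ :=
  g (load A E ω) - α * g (OPT (requests A E ω))

/-- Cost of `A` on `E` when `f` is to be maximized. -/
noncomputable def costMax (α : ℝ) (f : Vec n → ℝ≥0) (A : Policy n)
    (E : AdaptiveSequence n m q) : ℝ :=
  ∫ ω, lossMax α f A E ω ∂A.P

/-- Cost of `A` on `E` when `g` is to be minimized. -/
noncomputable def costMin (α : ℝ) (g : Vec n → ℝ≥0) (A : Policy n)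
    (E : AdaptiveSequence n m q) : ℝ :=
  ∫ ω, lossMin α g A E ω ∂A.P

end Game

/-- Worst-case `α`-regret of `A` over adaptive request sequences in `ℰ_{n,m,q}`, for the
maximization of `f`. -/
noncomputable def regretMax {n : ℕ} (m : ℕ) (q : ℝ≥0) (α : ℝ) (f : Vec n → ℝ≥0)
    (A : Policy n) : EReal :=
  ⨆ E : AdaptiveSequence n m q, (costMax α f A E : EReal)

/-- Worst-case `α`-regret of `A` over adaptive request sequences in `ℰ_{n,m,q}`, for the
minimization of `g`. -/
noncomputable def regretMin {n : ℕ} (m : ℕ) (q : ℝ≥0) (α : ℝ) (g : Vec n → ℝ≥0)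
    (A : Policy n) : EReal :=
  ⨆ E : AdaptiveSequence n m q, (costMin α g A E : EReal)

/-! ### Water-filling -/

/-- `x` solves the water-filling program for the node `ν` at current loads `l`: among the
feasible allocations of `ν` it maximizes `min_{i ∈ N} (x(i) + l(i))`. -/
def IsWaterFilling {n : ℕ} (ν : Node n) (l x : Vec n) : Prop :=
  ∃ hN : ν.1.Nonempty, x ∈ feasibleAllocations ν ∧
    ∀ y ∈ feasibleAllocations ν,
      ν.1.inf' hN (fun i => y i + l i) ≤ ν.1.inf' hN (fun i => x i + l i)

open Classical in
/-- The allocation `WF(N, q, l)` of water-filling, the solution of the program above (`0` for the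
excluded case of an empty neighbourhood). -/
noncomputable def waterFill {n : ℕ} (ν : Node n) (l : Vec n) : Vec n :=
  if h : ∃ x, IsWaterFilling ν l x then h.choose else 0

theorem exists_isWaterFilling {n : ℕ} (ν : Node n) (l : Vec n) (hN : ν.1.Nonempty) :
    ∃ x, IsWaterFilling ν l x := by
  have hcl : IsClosed (feasibleAllocations ν) := by
    have h1 : IsClosed {x : Vec n | ∀ i, i ∉ ν.1 → x i = 0} := by
      simp only [Set.ofPred_forall]
      exact isClosed_iInter fun i => isClosed_iInter fun _ =>
        isClosed_eq (continuous_apply i) continuous_const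
    have h2 : IsClosed {x : Vec n | ∑ i, x i = ν.2} :=
      isClosed_eq (by fun_prop) continuous_const
    exact h1.inter h2
  have hsub : feasibleAllocations ν ⊆ Set.Icc 0 (fun _ => ν.2) := by
    intro x hx
    refine ⟨fun i => zero_le, fun i => ?_⟩
    rw [← hx.2]
    exact Finset.single_le_sum (fun j _ => zero_le) (Finset.mem_univ i)
  have hc : IsCompact (feasibleAllocations ν) := isCompact_Icc.of_isClosed_subset hcl hsub
  have hne : (feasibleAllocations ν).Nonempty := by
    obtain ⟨i, hi⟩ := hN
    refine ⟨Pi.single i ν.2, fun j hj => ?_, by simp⟩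
    exact Pi.single_eq_of_ne (fun h : j = i => hj (h.symm ▸ hi)) _
  have hcont : Continuous fun x : Vec n => ν.1.inf' hN (fun i => x i + l i) :=
    Continuous.finset_inf'_apply hN fun i _ => by fun_prop
  obtain ⟨x, hx, hmax⟩ := hc.exists_isMaxOn hne hcont.continuousOn
  exact ⟨x, hN, hx, fun y hy => hmax hy⟩

theorem isWaterFilling_waterFill {n : ℕ} (ν : Node n) (l : Vec n) (hN : ν.1.Nonempty) :
    IsWaterFilling ν l (waterFill ν l) := by
  have h := exists_isWaterFilling ν l hN
  rw [waterFill, dif_pos h]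
  exact h.choose_spec

/-- Raising every node of `N` to level `c` and spreading what is left evenly is feasible, and
brings every node of `N` to level at least `c` plus an equal share of the rest. -/
theorem exists_level {n : ℕ} (ν : Node n) (l : Vec n) (hN : ν.1.Nonempty) (c : ℝ≥0)
    (hc : ∑ i ∈ ν.1, (c - l i) ≤ ν.2) :
    ∃ y ∈ feasibleAllocations ν, ∀ i ∈ ν.1,
      c + (ν.2 - ∑ i ∈ ν.1, (c - l i)) / ν.1.card ≤ y i + l i := by
  classical
  refine ⟨fun i => if i ∈ ν.1 then
    (c - l i) + (ν.2 - ∑ i ∈ ν.1, (c - l i)) / ν.1.card else 0, ⟨fun i hi => if_neg hi, ?_⟩,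
    fun i hi => ?_⟩
  · have hcard : (ν.1.card : ℝ≥0) ≠ 0 := by exact_mod_cast hN.card_ne_zero
    rw [Finset.sum_ite_mem, Finset.univ_inter, Finset.sum_add_distrib, Finset.sum_const,
      nsmul_eq_mul, mul_div_cancel₀ _ hcard, add_tsub_cancel_of_le hc]
  · beta_reduce
    rw [if_pos hi]
    have : c ≤ c - l i + l i := le_tsub_add
    calc c + (ν.2 - ∑ i ∈ ν.1, (c - l i)) / ν.1.card
        ≤ (c - l i + l i) + (ν.2 - ∑ i ∈ ν.1, (c - l i)) / ν.1.card := by gcongr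
      _ = _ := by ring

/-- Closed form of the solution: the nodes of `N` are raised to a common level. -/
theorem IsWaterFilling.eq_level {n : ℕ} {ν : Node n} {l x : Vec n} (h : IsWaterFilling ν l x)
    (hN : ν.1.Nonempty) :
    (∑ i ∈ ν.1, (ν.1.inf' hN (fun i => x i + l i) - l i) = ν.2) ∧
      ∀ i ∈ ν.1, x i = ν.1.inf' hN (fun i => x i + l i) - l i := by
  obtain ⟨_, ⟨hx0, hxs⟩, hmax⟩ := h
  set L := ν.1.inf' hN (fun i => x i + l i) with hL
  have hle : ∀ i ∈ ν.1, L - l i ≤ x i := fun i hi => by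
    rw [tsub_le_iff_right]
    exact Finset.inf'_le (fun i => x i + l i) hi
  have hsum : ∑ i ∈ ν.1, x i = ν.2 := by
    rw [← hxs]
    exact Finset.sum_subset (Finset.subset_univ _) fun i _ hi => hx0 i hi
  have hs : ∑ i ∈ ν.1, (L - l i) ≤ ν.2 := hsum ▸ Finset.sum_le_sum hle
  have heq : ∑ i ∈ ν.1, (L - l i) = ν.2 := by
    by_contra hne
    have hlt := lt_of_le_of_ne hs hne
    obtain ⟨y, hy, hyl⟩ := exists_level ν l hN L hs
    have h1 := hmax y hy
    have h2 : L + (ν.2 - ∑ i ∈ ν.1, (L - l i)) / ν.1.card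
        ≤ ν.1.inf' hN (fun i => y i + l i) := Finset.le_inf' hN _ hyl
    have h3 : 0 < (ν.2 - ∑ i ∈ ν.1, (L - l i)) / ν.1.card :=
      div_pos (tsub_pos_of_lt hlt) (by exact_mod_cast hN.card_pos)
    exact absurd (h2.trans h1) (not_le.2 (lt_add_of_pos_right _ h3))
  refine ⟨heq, fun i hi => ?_⟩
  have := (Finset.sum_eq_sum_iff_of_le hle).1 (heq.trans hsum.symm)
  exact (this i hi).symm

theorem measurable_waterFill {n : ℕ} :
    Measurable fun p : Node n × Vec n => waterFill p.1 p.2 := by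
  have key : ∀ N : Finset (Fin n),
      Measurable fun r : ℝ≥0 × Vec n => waterFill (N, r.1) r.2 := by
    intro N
    by_cases hN : N.Nonempty
    · have hw : ∀ r : ℝ≥0 × Vec n, IsWaterFilling (N, r.1) r.2 (waterFill (N, r.1) r.2) :=
        fun r => isWaterFilling_waterFill (N, r.1) r.2 hN
      let L : ℝ≥0 × Vec n → ℝ≥0 := fun r => N.inf' hN (fun i => waterFill (N, r.1) r.2 i + r.2 i)
      have hLm : Measurable L := by
        refine measurable_of_Ici fun c => ?_
        have : L ⁻¹' Set.Ici c = {r : ℝ≥0 × Vec n | ∑ i ∈ N, (c - r.2 i) ≤ r.1} := by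
          ext r
          constructor
          · intro hc
            have hc' : c ≤ L r := hc
            calc ∑ i ∈ N, (c - r.2 i) ≤ ∑ i ∈ N, (L r - r.2 i) :=
                  Finset.sum_le_sum fun i _ => tsub_le_tsub_right hc' _
              _ = r.1 := ((hw r).eq_level hN).1
          · intro hc
            obtain ⟨y, hy, hyl⟩ := exists_level (N, r.1) r.2 hN c hc
            obtain ⟨_, _, hmax⟩ := hw r
            exact (Finset.le_inf' hN _ fun i hi => le_self_add.trans (hyl i hi)).trans (hmax y hy)
        rw [this]
        exact measurableSet_le (by fun_prop) (by fun_prop)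
      refine measurable_pi_lambda _ fun i => ?_
      by_cases hi : i ∈ N
      · have : (fun r : ℝ≥0 × Vec n => waterFill (N, r.1) r.2 i) = fun r => L r - r.2 i :=
          funext fun r => ((hw r).eq_level hN).2 i hi
        rw [this]
        fun_prop
      · have : (fun r : ℝ≥0 × Vec n => waterFill (N, r.1) r.2 i) = fun _ => 0 :=
          funext fun r => (hw r).choose_spec.1.1 i hi
        rw [this]
        exact measurable_const
    · have : (fun r : ℝ≥0 × Vec n => waterFill (N, r.1) r.2) = fun _ => 0 := by
        funext r
        exact dif_neg fun ⟨_, h, _⟩ => hN h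
      rw [this]
      exact measurable_const
  have h2 : Measurable fun p : Finset (Fin n) × (ℝ≥0 × Vec n) => waterFill (p.1, p.2.1) p.2.2 :=
    measurable_from_prod_countable_right key
  exact h2.comp (f := fun p : Node n × Vec n => (p.1.1, p.1.2, p.2)) (by fun_prop)

/-- The (deterministic) water-filling policy: at each arrival, solve the water-filling program at
the current load vector. -/
noncomputable def WF (n : ℕ) : Policy.{0} n where
  Ω := Unit
  P := Measure.dirac ()
  act _ _ h ν := waterFill ν (∑ s, (h s).2)
  act_feasible _ _ _ ν hN := (isWaterFilling_waterFill ν _ hN).choose_spec.1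
  measurable_act t := measurable_waterFill.comp
    (f := fun p : Unit × (Fin t → Round n) × Node n => (p.2.2, ∑ s, (p.2.1 s).2)) (by fun_prop)

end WaterFilling

namespace WaterFilling

/-! ### Majorization -/

/-! Water-filling is deterministic, so its game against an adaptive `E` yields one static sequence,
with final load l and a water level L_t in each round. From these data a nested adversary is built
which, against every policy and for all coin flips, forces a load majorizing l and a hindsight
optimum majorized by that of the static sequence (`IsLeveled.exists_adaptiveSequence`). Schur
monotonicity and α ≥ 0 compare the losses pointwise; integration compares the regrets.

The adversary replays the quantities in increasing order of level. At level L it requests the #{i :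
l(i) ≥ L} currently most loaded nodes of the previous neighbourhood.

Loads: every policy leaves at most ∑_{l(i) < L} l(i) outside the neighbourhood of level L
(`sum_compl_nested_le`). When the neighbourhood shrinks, the discarded nodes carry on average no
more than the old neighbourhood does, and the total so far is at most ∑ min(l(i), L), because the
water-filling rounds of level ≤ L give each node at most L (`IsLeveled.sum_quantity_le`). Nonzero
values of l are levels, so all upper level sets of l are controlled.

Optima: a Hall-type criterion compares them through the quantities confined to sets of nodes
(`IsBalanced.majorizes`). The original neighbourhood of level L lies in {l ≥ L}, which has the size
of its nested replacement (`majorizes_nested_optimum`). -/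

theorem antitone_decreasing {n : ℕ} (x : Vec n) : Antitone (decreasing x) := fun _ _ hij =>
  Tuple.monotone_sort x (Fin.rev_le_rev.2 hij)

theorem sum_decreasing {n : ℕ} (x : Vec n) (F : ℝ≥0 → ℝ≥0) :
    ∑ i, F (decreasing x i) = ∑ i, F (x i) :=
  Equiv.sum_comp (Fin.revPerm.trans (Tuple.sort x)) fun i => F (x i)

/-- Comparison of the excesses over every threshold implies majorization. -/
theorem majorizes_of_sum_tsub_le {n : ℕ} {x y : Vec n} (hs : ∑ i, x i = ∑ i, y i)
    (h : ∀ c : ℝ≥0, ∑ i, (y i - c) ≤ ∑ i, (x i - c)) : Majorizes x y := by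
  refine ⟨hs, fun j hj => ?_⟩
  rcases Nat.eq_zero_or_pos j with rfl | hj0
  · simp
  -- With the `j`-th largest entry of `x` as threshold, the bound by `j * c` plus the excess is an
  -- equality for `x`.
  set c := decreasing x ⟨j - 1, by omega⟩ with hc
  calc ∑ i with (i : Fin n).val < j, decreasing y i
      ≤ ∑ i with (i : Fin n).val < j, (c + (decreasing y i - c)) :=
        Finset.sum_le_sum fun i _ => le_add_tsub
    _ ≤ ∑ i with (i : Fin n).val < j, c + ∑ i, (decreasing y i - c) := by
        rw [Finset.sum_add_distrib]
        gcongr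
        exact Finset.subset_univ _
    _ ≤ ∑ i with (i : Fin n).val < j, c + ∑ i, (decreasing x i - c) := by
        refine add_le_add le_rfl ?_
        rw [sum_decreasing y (· - c), sum_decreasing x (· - c)]
        exact h c
    _ = ∑ i with (i : Fin n).val < j, c +
          ∑ i with (i : Fin n).val < j, (decreasing x i - c) := by
        congr 1
        refine (Finset.sum_subset (Finset.subset_univ _) fun i _ hi => ?_).symm
        simp only [Finset.mem_filter, Finset.mem_univ, true_and, not_lt] at hi
        exact tsub_eq_zero_of_le (antitone_decreasing x (Fin.le_def.2 (by simp; omega)))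
    _ = ∑ i with (i : Fin n).val < j, decreasing x i := by
        rw [← Finset.sum_add_distrib]
        refine Finset.sum_congr rfl fun i hi => ?_
        simp only [Finset.mem_filter, Finset.mem_univ, true_and] at hi
        exact add_tsub_cancel_of_le (antitone_decreasing x (Fin.le_def.2 (by simp; omega)))

/-- With the next lemma: the excess of `x` over `c` is the maximum over `G` of x(G) - c|G|, attained
at the strict upper level set. -/
theorem sum_le_card_mul_add_sum_tsub {n : ℕ} (x : Vec n) (c : ℝ≥0) (G : Finset (Fin n)) :
    ∑ i ∈ G, x i ≤ G.card * c + ∑ i, (x i - c) := by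
  calc ∑ i ∈ G, x i ≤ ∑ i ∈ G, (c + (x i - c)) := Finset.sum_le_sum fun i _ => le_add_tsub
    _ = G.card * c + ∑ i ∈ G, (x i - c) := by
        rw [Finset.sum_add_distrib, Finset.sum_const, nsmul_eq_mul]
    _ ≤ _ := by
        gcongr
        exact Finset.subset_univ _

theorem sum_lt_eq_card_mul_add_sum_tsub {n : ℕ} (x : Vec n) (c : ℝ≥0) :
    ∑ i with c < x i, x i = (Finset.univ.filter fun i => c < x i).card * c + ∑ i, (x i - c) := by
  have h : ∑ i, (x i - c) = ∑ i with c < x i, (x i - c) := by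
    refine (Finset.sum_subset (Finset.subset_univ _) fun i _ hi => ?_).symm
    simp only [Finset.mem_filter, Finset.mem_univ, true_and, not_lt] at hi
    exact tsub_eq_zero_of_le hi
  rw [h, ← nsmul_eq_mul, ← Finset.sum_const, ← Finset.sum_add_distrib]
  refine Finset.sum_congr rfl fun i hi => (add_tsub_cancel_of_le ?_).symm
  exact (Finset.mem_filter.1 hi).2.le

/-- It suffices to exhibit, for each upper level set `H` of `y`, a set `G` that is no larger and
carries at least as much of `x` as `H` carries of `y`. -/
theorem majorizes_of_level_sets {n : ℕ} {x y : Vec n} (hs : ∑ i, x i = ∑ i, y i)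
    (h : ∀ c : ℝ≥0, ∃ G : Finset (Fin n), G.card ≤ (Finset.univ.filter fun i => c < y i).card ∧
      ∑ i with c < y i, y i ≤ ∑ i ∈ G, x i) : Majorizes x y := by
  refine majorizes_of_sum_tsub_le hs fun c => ?_
  obtain ⟨G, hG, hle⟩ := h c
  rw [sum_lt_eq_card_mul_add_sum_tsub] at hle
  have h1 := hle.trans (sum_le_card_mul_add_sum_tsub x c G)
  refine le_of_add_le_add_left (h1.trans ?_)
  gcongr

/-- This and `majorizes_single` give the extremes of the order at fixed total; they serve to bound
the losses. -/
theorem majorizes_const {n : ℕ} (x : Vec n) : Majorizes x fun _ => (∑ i, x i) / n := by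
  rcases Nat.eq_zero_or_pos n with rfl | hn
  · exact ⟨by simp, fun j _ => by simp⟩
  have hn' : (n : ℝ≥0) ≠ 0 := by exact_mod_cast hn.ne'
  have hs : ∑ i : Fin n, x i = ∑ _i : Fin n, (∑ i, x i) / n := by
    rw [Finset.sum_const, Finset.card_univ, Fintype.card_fin, nsmul_eq_mul,
      mul_div_cancel₀ _ hn']
  refine majorizes_of_level_sets hs fun c =>
    ⟨Finset.univ.filter fun _ => c < (∑ i, x i) / n, le_rfl, ?_⟩
  by_cases hc : c < (∑ i, x i) / n
  · simp only [hc, Finset.filter_true]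
    exact hs.ge
  · simp [hc]

theorem majorizes_single {n : ℕ} (x : Vec n) (i₀ : Fin n) :
    Majorizes (Pi.single i₀ (∑ i, x i)) x := by
  refine majorizes_of_level_sets (by simp) fun c => ?_
  by_cases hc : ∃ i, c < x i
  · obtain ⟨i, hi⟩ := hc
    refine ⟨{i₀}, ?_, ?_⟩
    · rw [Finset.card_singleton]
      exact Finset.card_pos.2 ⟨i, by simpa using hi⟩
    · rw [Finset.sum_singleton, Pi.single_eq_same]
      exact Finset.sum_le_sum_of_subset (Finset.subset_univ _)
  · push Not at hc
    exact ⟨∅, by simp, by simp [Finset.filter_false_of_mem fun i _ => not_lt.2 (hc i)]⟩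

/-! ### Balanced allocations and hindsight optima -/

theorem isCompact_feasibleAllocations {n : ℕ} (ν : Node n) :
    IsCompact (feasibleAllocations ν) := by
  have h1 : IsClosed {x : Vec n | ∀ i, i ∉ ν.1 → x i = 0} := by
    simp only [Set.ofPred_forall]
    exact isClosed_iInter fun i => isClosed_iInter fun _ =>
      isClosed_eq (continuous_apply i) continuous_const
  have h2 : IsClosed {x : Vec n | ∑ i, x i = ν.2} :=
    isClosed_eq (by fun_prop) continuous_const
  refine isCompact_Icc.of_isClosed_subset (s := Set.Icc 0 (fun _ => ν.2)) (h1.inter h2) ?_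
  intro x hx
  refine ⟨fun i => zero_le, fun i => ?_⟩
  rw [← hx.2]
  exact Finset.single_le_sum (fun j _ => zero_le) (Finset.mem_univ i)

theorem nonempty_feasibleAllocations {n : ℕ} (ν : Node n) (hN : ν.1.Nonempty) :
    (feasibleAllocations ν).Nonempty :=
  ⟨_, (isWaterFilling_waterFill ν 0 hN).choose_spec.1⟩

/-- The allocations `x` only use nodes of least load. -/
def IsBalanced {n m : ℕ} (E : Fin m → Node n) (x : Fin m → Vec n) : Prop :=
  (∀ t, x t ∈ feasibleAllocations (E t)) ∧
    ∀ t i j, x t i ≠ 0 → j ∈ (E t).1 → ∑ s, x s i ≤ ∑ s, x s j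

/-- Moving a small amount from `i` to a node `j` of smaller load decreases the sum of squares. -/
theorem sum_sq_transfer_lt {n : ℕ} {l l' : Fin n → ℝ} {i j : Fin n} {ε : ℝ} (hε : 0 < ε)
    (hij : l j + 2 * ε ≤ l i)
    (h : ∀ k, l' k = l k + ε * ((if k = j then 1 else 0) - if k = i then 1 else 0)) :
    ∑ k, l' k ^ 2 < ∑ k, l k ^ 2 := by
  have hne : i ≠ j := by
    rintro rfl
    linarith
  have hk : ∀ k, l' k ^ 2 = l k ^ 2 + ((if k = j then 2 * ε * l k + ε ^ 2 else 0) +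
      if k = i then -2 * ε * l k + ε ^ 2 else 0) := by
    intro k
    rw [h k]
    by_cases h1 : k = j
    · have h2 : k ≠ i := fun h2 => hne (h2.symm.trans h1)
      simp only [if_pos h1, if_neg h2]
      ring
    · by_cases h2 : k = i
      · simp only [if_neg h1, if_pos h2]
        ring
      · simp only [if_neg h1, if_neg h2]
        ring
  simp only [hk, Finset.sum_add_distrib, Finset.sum_ite_eq', Finset.mem_univ, if_true]
  -- The net change is 2ε(l j - l i) + 2ε², at most -2ε².
  nlinarith

/-- A minimizer of the sum of squared loads is balanced: otherwise a small transfer to a less loaded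
neighbour would improve it. -/
theorem exists_isBalanced {n m : ℕ} (E : Fin m → Node n) (hN : ∀ t, (E t).1.Nonempty) :
    ∃ x, IsBalanced E x := by
  have hc : IsCompact (Set.univ.pi fun t => feasibleAllocations (E t)) :=
    isCompact_univ_pi fun t => isCompact_feasibleAllocations (E t)
  have hne : (Set.univ.pi fun t => feasibleAllocations (E t)).Nonempty :=
    Set.univ_pi_nonempty_iff.2 fun t => nonempty_feasibleAllocations (E t) (hN t)
  have hcont : Continuous fun x : Fin m → Vec n => ∑ i, ((∑ t, x t i : ℝ≥0) : ℝ) ^ 2 := by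
    fun_prop
  obtain ⟨x, hx, hmin⟩ := hc.exists_isMinOn hne hcont.continuousOn
  have hxf : ∀ t, x t ∈ feasibleAllocations (E t) := fun t => hx t trivial
  refine ⟨x, hxf, fun t i j hi hj => ?_⟩
  by_contra! hlt
  have hij : i ≠ j := by
    rintro rfl
    exact hlt.false
  have hiN : i ∈ (E t).1 := by
    by_contra h
    exact hi ((hxf t).1 i h)
  set l : Vec n := fun k => ∑ s, x s k with hl
  -- The first bound keeps the allocation nonnegative (no truncation in `z`); the second keeps `i`
  -- at least as loaded as `j`.
  set ε : ℝ≥0 := min (x t i) ((l i - l j) / 2) with hε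
  have hε0 : 0 < ε := lt_min (pos_iff_ne_zero.2 hi) (div_pos (tsub_pos_of_lt hlt) two_pos)
  have hεx : ε ≤ x t i := min_le_left _ _
  have hεl : (l j : ℝ) + 2 * ε ≤ l i := by
    have h1 : ε ≤ (l i - l j) / 2 := min_le_right _ _
    have h2 : (ε : ℝ) ≤ ((l i - l j) / 2 : ℝ≥0) := by exact_mod_cast h1
    rw [NNReal.coe_div, NNReal.coe_sub hlt.le, NNReal.coe_two] at h2
    change (_ : ℝ) ≤ ((l i : ℝ) - l j) / 2 at h2
    linarith
  set z : Vec n := fun k => x t k + (if k = j then ε else 0) - if k = i then ε else 0 with hz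
  have hzx : ∀ k, (z k : ℝ) = x t k + ε * ((if k = j then 1 else 0) - if k = i then 1 else 0) := by
    intro k
    by_cases h1 : k = j
    · have h2 : k ≠ i := fun h2 => hij (h2.symm.trans h1)
      simp [hz, if_pos h1, if_neg h2]
    · by_cases h2 : k = i
      · subst h2
        simp [hz, if_neg h1, NNReal.coe_sub hεx]
        ring
      · simp [hz, if_neg h1, if_neg h2]
  have hzf : z ∈ feasibleAllocations (E t) := by
    refine ⟨fun k hk => ?_, ?_⟩
    · have h1 : k ≠ j := fun h => hk (h ▸ hj)
      have h2 : k ≠ i := fun h => hk (h ▸ hiN)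
      simp [hz, h1, h2, (hxf t).1 k hk]
    · have : ((∑ k, z k : ℝ≥0) : ℝ) = (∑ k, x t k : ℝ≥0) := by
        push_cast
        simp only [hzx, Finset.sum_add_distrib, ← Finset.mul_sum, Finset.sum_sub_distrib,
          Finset.sum_ite_eq', Finset.mem_univ, if_true]
        ring
      rw [← (hxf t).2]
      exact_mod_cast this
  have hle := hmin (a := Function.update x t z) fun s _ => by
    by_cases hs : s = t
    · subst hs
      simpa using hzf
    · simpa [Function.update_of_ne hs] using hxf s
  refine absurd hle (not_le.2 (sum_sq_transfer_lt (ε := ε) (i := i) (j := j)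
    (by exact_mod_cast hε0) hεl fun k => ?_))
  have h1 : ∑ s, Function.update x t z s k = z k + ∑ s ∈ Finset.univ.erase t, x s k := by
    rw [← Finset.add_sum_erase _ _ (Finset.mem_univ t), Function.update_self]
    congr 1
    refine Finset.sum_congr rfl fun s hs => ?_
    rw [Function.update_of_ne (Finset.ne_of_mem_erase hs)]
  have h2 : ∑ s, x s k = x t k + ∑ s ∈ Finset.univ.erase t, x s k :=
    (Finset.add_sum_erase _ (fun s => x s k) (Finset.mem_univ t)).symm
  rw [h1, h2]
  push_cast
  rw [hzx]
  ring

theorem sum_sum_of_feasible {n m : ℕ} {E : Fin m → Node n} {x : Fin m → Vec n}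
    (hx : ∀ t, x t ∈ feasibleAllocations (E t)) : ∑ i, (∑ t, x t) i = ∑ t, (E t).2 := by
  simp only [Finset.sum_apply]
  rw [Finset.sum_comm]
  exact Finset.sum_congr rfl fun t _ => (hx t).2

theorem sum_of_mem_feasibleLoads {n m : ℕ} {E : Fin m → Node n} {l : Vec n}
    (hl : l ∈ feasibleLoads E) : ∑ i, l i = ∑ t, (E t).2 := by
  obtain ⟨x, hx, rfl⟩ := hl
  exact sum_sum_of_feasible hx

/-- Quantities of nodes with neighbourhood inside `G` cannot be placed elsewhere. Balanced loads
attain equality on their upper level sets. -/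
theorem sum_quantity_subset_le {n m : ℕ} {E : Fin m → Node n} {l : Vec n}
    (hl : l ∈ feasibleLoads E) (G : Finset (Fin n)) :
    ∑ t with (E t).1 ⊆ G, (E t).2 ≤ ∑ i ∈ G, l i := by
  obtain ⟨x, hx, rfl⟩ := hl
  simp only [Finset.sum_apply]
  rw [Finset.sum_comm]
  calc ∑ t with (E t).1 ⊆ G, (E t).2 ≤ ∑ t with (E t).1 ⊆ G, ∑ i ∈ G, x t i := by
        refine Finset.sum_le_sum fun t ht => ?_
        rw [← (hx t).2]
        refine (Finset.sum_subset (Finset.subset_univ _) fun i _ hi => (hx t).1 i fun h => ?_).ge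
        exact hi ((Finset.mem_filter.1 ht).2 h)
    _ ≤ _ := Finset.sum_le_sum_of_subset (Finset.subset_univ _)

/-- The upper level sets of a balanced load only receive the quantities that are confined to
them. -/
theorem IsBalanced.sum_level_le {n m : ℕ} {E : Fin m → Node n} {x : Fin m → Vec n}
    (hx : IsBalanced E x) (c : ℝ≥0) :
    ∑ i with c < (∑ t, x t) i, (∑ t, x t) i ≤
      ∑ t with (E t).1 ⊆ Finset.univ.filter fun i => c < (∑ t, x t) i, (E t).2 := by
  set H := Finset.univ.filter fun i => c < (∑ t, x t) i with hH
  simp only [Finset.sum_apply]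
  rw [Finset.sum_comm, Finset.sum_filter]
  refine Finset.sum_le_sum fun t _ => ?_
  split_ifs with ht
  · rw [← (hx.1 t).2]
    exact Finset.sum_le_sum_of_subset (Finset.subset_univ _)
  · refine (Finset.sum_eq_zero fun i hi => ?_).le
    by_contra hne
    refine ht fun j hj => ?_
    have h1 := hx.2 t i j hne hj
    simp only [hH, Finset.mem_filter, Finset.mem_univ, true_and, Finset.sum_apply] at hi ⊢
    exact hi.trans_le h1

/-- A feasible load of `E'` majorizes the balanced load of `E`, provided the quantities that `E`
confines to a set can be confined to a set of at most the same size in `E'`. -/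
theorem IsBalanced.majorizes {n m m' : ℕ} {E : Fin m → Node n} {E' : Fin m' → Node n}
    {x : Fin m → Vec n} (hx : IsBalanced E x) {l : Vec n} (hl : l ∈ feasibleLoads E')
    (hq : ∑ t, (E' t).2 = ∑ t, (E t).2)
    (h : ∀ H : Finset (Fin n), ∃ G : Finset (Fin n), G.card ≤ H.card ∧
      ∑ t with (E t).1 ⊆ H, (E t).2 ≤ ∑ t with (E' t).1 ⊆ G, (E' t).2) :
    Majorizes l (∑ t, x t) := by
  refine majorizes_of_level_sets ?_ fun c => ?_
  · rw [sum_sum_of_feasible hx.1, sum_of_mem_feasibleLoads hl, hq]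
  · obtain ⟨G, hG, hle⟩ := h (Finset.univ.filter fun i => c < (∑ t, x t) i)
    exact ⟨G, hG, (hx.sum_level_le c).trans (hle.trans (sum_quantity_subset_le hl G))⟩

/-- A balanced load is minimal by the criterion above with `E' = E` and `G = H`, so `OPT` is not its
default value. -/
theorem isHindsightOptimal_OPT {n m : ℕ} (E : Fin m → Node n) (hN : ∀ t, (E t).1.Nonempty) :
    IsHindsightOptimal E (OPT E) := by
  obtain ⟨x, hx⟩ := exists_isBalanced E hN
  have h : ∃ l, IsHindsightOptimal E l :=
    ⟨∑ t, x t, ⟨x, hx.1, rfl⟩, fun l hl => hx.majorizes hl rfl fun H => ⟨H, le_rfl, le_rfl⟩⟩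
  rw [OPT, dif_pos h]
  exact h.choose_spec

/-! ### The most loaded nodes -/

/-- `T` consists of `k` elements of `S`, each `r`-above all other elements of `S`. -/
def IsTop {n : ℕ} (r : Fin n → Fin n → Prop) (S : Finset (Fin n)) (k : ℕ)
    (T : Finset (Fin n)) : Prop :=
  T ⊆ S ∧ T.card = k ∧ ∀ i ∈ T, ∀ j ∈ S \ T, r j i

theorem exists_isTop {n : ℕ} (a : Vec n) (S : Finset (Fin n)) {k : ℕ} (hk : k ≤ S.card) :
    ∃ T, IsTop (fun j i => a j ≤ a i) S k T := by
  induction k with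
  | zero => exact ⟨∅, by simp [IsTop]⟩
  | succ k ih =>
    obtain ⟨T, hTS, hTk, hT⟩ := ih (by omega)
    have hne : (S \ T).Nonempty := by
      rw [Finset.sdiff_nonempty]
      intro h
      have := Finset.card_le_card h
      omega
    obtain ⟨i₀, hi₀, hmax⟩ := Finset.exists_max_image (S \ T) a hne
    rw [Finset.mem_sdiff] at hi₀
    refine ⟨insert i₀ T, Finset.insert_subset hi₀.1 hTS, ?_, fun i hi j hj => ?_⟩
    · rw [Finset.card_insert_of_notMem hi₀.2, hTk]
    · simp only [Finset.mem_sdiff, Finset.mem_insert, not_or] at hj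
      have hj' : j ∈ S \ T := Finset.mem_sdiff.2 ⟨hj.1, hj.2.2⟩
      rcases Finset.mem_insert.1 hi with rfl | hi
      · exact hmax j hj'
      · exact hT i hi j hj'

open Classical in
/-- A choice of `k` top elements of `S`; it depends on the order relation only. -/
noncomputable def topSet {n : ℕ} (r : Fin n → Fin n → Prop) (S : Finset (Fin n)) (k : ℕ) :
    Finset (Fin n) :=
  if h : ∃ T, IsTop r S k T then h.choose else ∅

theorem isTop_topSet {n : ℕ} (a : Vec n) (S : Finset (Fin n)) {k : ℕ} (hk : k ≤ S.card) :
    IsTop (fun j i => a j ≤ a i) S k (topSet (fun j i => a j ≤ a i) S k) := by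
  have h := exists_isTop a S hk
  rw [topSet, dif_pos h]
  exact h.choose_spec

theorem measurable_topSet {n : ℕ} (k : ℕ) :
    Measurable fun p : Vec n × Finset (Fin n) => topSet (fun j i => p.1 j ≤ p.1 i) p.2 k := by
  have h1 : Measurable fun a : Vec n => fun j i : Fin n => (a j ≤ a i : Prop) :=
    measurable_pi_lambda _ fun j => measurable_pi_lambda _ fun i =>
      measurableSet_setOfPred.1 (measurableSet_le (measurable_pi_apply j) (measurable_pi_apply i))
  -- There are finitely many relations and sets, so the arbitrary choice in `topSet` is harmless.
  have h2 : Measurable fun p : (Fin n → Fin n → Prop) × Finset (Fin n) => topSet p.1 p.2 k :=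
    measurable_of_countable _
  exact h2.comp (f := fun p : Vec n × Finset (Fin n) =>
    ((fun j i : Fin n => (p.1 j ≤ p.1 i : Prop)), p.2))
    ((h1.comp measurable_fst).prodMk measurable_snd)

/-- The average over the top part is at least that over the rest, cross-multiplied so that either
part may be empty. -/
theorem IsTop.card_mul_sum_sdiff_le {n : ℕ} {a : Vec n} {S T : Finset (Fin n)} {k : ℕ}
    (h : IsTop (fun j i => a j ≤ a i) S k T) :
    (T.card : ℝ≥0) * ∑ j ∈ S \ T, a j ≤ (S \ T).card * ∑ i ∈ T, a i := by
  calc (T.card : ℝ≥0) * ∑ j ∈ S \ T, a j = ∑ _i ∈ T, ∑ j ∈ S \ T, a j := by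
        rw [Finset.sum_const, nsmul_eq_mul]
    _ ≤ ∑ i ∈ T, ∑ _j ∈ S \ T, a i :=
        Finset.sum_le_sum fun i hi => Finset.sum_le_sum fun j hj => h.2.2 i hi j hj
    _ = _ := by
        simp only [Finset.sum_const, nsmul_eq_mul, Finset.mul_sum]

/-! ### The nested adversary -/

/-- The neighbourhood of the last round; all nodes if there is none. -/
def lastSet {n : ℕ} : (t : ℕ) → (Fin t → Round n) → Finset (Fin n)
  | 0, _ => Finset.univ
  | t + 1, h => (h (Fin.last t)).1.1

theorem measurable_lastSet {n : ℕ} (t : ℕ) : Measurable (lastSet (n := n) t) := by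
  cases t with
  | zero => exact measurable_const
  | succ t => exact (measurable_fst.comp measurable_fst).comp (measurable_pi_apply (Fin.last t))

/-- Request the `K t` most loaded nodes of the last neighbourhood, with quantity `Q t`. -/
noncomputable def nestedNext {n : ℕ} (K : ℕ → ℕ) (Q : ℕ → ℝ≥0) (t : ℕ)
    (h : Fin t → Round n) : Node n :=
  (topSet (fun j i => (∑ s, (h s).2) j ≤ (∑ s, (h s).2) i) (lastSet t h) (K t), Q t)

theorem measurable_nestedNext {n : ℕ} (K : ℕ → ℕ) (Q : ℕ → ℝ≥0) (t : ℕ) :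
    Measurable (nestedNext (n := n) K Q t) := by
  refine Measurable.prodMk ?_ measurable_const
  exact (measurable_topSet (K t)).comp
    (f := fun h : Fin t → Round n => (∑ s, (h s).2, lastSet t h))
    ((by fun_prop : Measurable fun h : Fin t → Round n => ∑ s, (h s).2).prodMk
      (measurable_lastSet t))

theorem IsHistory.castLE {n t m : ℕ} {next : (t : ℕ) → (Fin t → Round n) → Node n}
    {h : Fin m → Round n} (hh : IsHistory next m h) (htm : t ≤ m) :
    IsHistory next t fun r => h (Fin.castLE htm r) :=
  fun s => hh (Fin.castLE htm s)

/-- Enough nodes always remain, so `topSet` never falls back to its default. -/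
theorem card_lastSet {n : ℕ} {K : ℕ → ℕ} {Q : ℕ → ℝ≥0} (hK : Antitone K) (hKn : K 0 ≤ n) (t : ℕ)
    {h : Fin t → Round n} (hh : IsHistory (nestedNext K Q) t h) : K t ≤ (lastSet t h).card := by
  induction t with
  | zero => simpa [lastSet] using hKn
  | succ t ih =>
    have h1 := (hh (Fin.last t)).1
    have h2 := ih (hh.castLE (Nat.le_succ t))
    have h3 := (isTop_topSet (∑ s : Fin t, (h (Fin.castLE (Nat.le_succ t) s)).2) _ h2).2.1
    rw [lastSet, h1]
    exact (hK (Nat.le_succ t)).trans h3.ge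

theorem isTop_nestedNext {n : ℕ} {K : ℕ → ℕ} {Q : ℕ → ℝ≥0} (hK : Antitone K) (hKn : K 0 ≤ n)
    (t : ℕ) {h : Fin t → Round n} (hh : IsHistory (nestedNext K Q) t h) :
    IsTop (fun j i => (∑ s, (h s).2) j ≤ (∑ s, (h s).2) i) (lastSet t h) (K t)
      (nestedNext K Q t h).1 :=
  isTop_topSet _ _ (card_lastSet hK hKn t hh)

/-- The adaptive request sequence of nested neighbourhoods of sizes `K t` and quantities `Q t`. -/
noncomputable def nestedAdversary {n m : ℕ} {q : ℝ≥0} (K : ℕ → ℕ) (Q : ℕ → ℝ≥0)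
    (hK : Antitone K) (hKn : K 0 ≤ n) (hK0 : ∀ t, 0 < K t) (hQ : ∀ t, 0 < Q t)
    (hq : ∑ t ∈ Finset.range m, Q t = q) : AdaptiveSequence n m q where
  next := nestedNext K Q
  measurable_next := measurable_nestedNext K Q
  neighbourhood_nonempty t _ h hh := by
    rw [← Finset.card_pos, (isTop_nestedNext hK hKn t hh).2.1]
    exact hK0 t
  quantity_pos t _ _ _ := hQ t
  total_quantity h hh := by
    rw [← hq, Finset.sum_range]
    exact Finset.sum_congr rfl fun t _ => by rw [(hh t).1]; rfl

/-- One round of the nested adversary: `S ⊇ T` are consecutive neighbourhoods, `a` is the load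
between the two, and `l` is the load vector that `a` is compared with. -/
theorem IsTop.sum_compl_le {n : ℕ} {a l : Vec n} {S T : Finset (Fin n)} {c c' : ℝ≥0}
    (h : IsTop (fun j i => a j ≤ a i) S (Finset.univ.filter fun i => c' ≤ l i).card T)
    (hS : S.card = (Finset.univ.filter fun i => c ≤ l i).card) (hS0 : 0 < S.card) (hc : c ≤ c')
    (hD : ∑ i ∈ Sᶜ, a i ≤ ∑ i with ¬ c ≤ l i, l i)
    (hV : ∑ i, a i ≤ ∑ i, min (l i) c) :
    ∑ i ∈ Tᶜ, a i ≤ ∑ i with ¬ c' ≤ l i, l i := by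
  have hmin : ∑ i, min (l i) c = ∑ i with ¬ c ≤ l i, l i + S.card * c := by
    rw [hS, ← Finset.sum_filter_not_add_sum_filter (s := Finset.univ) fun i => c ≤ l i]
    congr 1
    · refine Finset.sum_congr rfl fun i hi => min_eq_left ?_
      exact (not_le.1 (Finset.mem_filter.1 hi).2).le
    · rw [← nsmul_eq_mul, ← Finset.sum_const]
      exact Finset.sum_congr rfl fun i hi => min_eq_right (Finset.mem_filter.1 hi).2
  have hsub : (Finset.univ.filter fun i => c' ≤ l i) ⊆ Finset.univ.filter fun i => c ≤ l i :=
    fun i hi => by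
      simp only [Finset.mem_filter, Finset.mem_univ, true_and] at hi ⊢
      exact hc.trans hi
  -- As many nodes are discarded as have `l` in [c, c'), and each of the latter carries at least
  -- `c`.
  have hC : ∑ i with ¬ c ≤ l i, l i + (S \ T).card * c ≤ ∑ i with ¬ c' ≤ l i, l i := by
    have h1 : (S \ T).card =
        ((Finset.univ.filter fun i => c ≤ l i) \ Finset.univ.filter fun i => c' ≤ l i).card := by
      rw [Finset.card_sdiff_of_subset h.1, Finset.card_sdiff_of_subset hsub, hS, h.2.1]
    rw [h1, ← nsmul_eq_mul, ← Finset.sum_const]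
    calc _ ≤ ∑ i with ¬ c ≤ l i, l i + ∑ i ∈ (Finset.univ.filter fun i => c ≤ l i) \
              Finset.univ.filter fun i => c' ≤ l i, l i := by
          gcongr with i hi
          exact (Finset.mem_filter.1 (Finset.mem_sdiff.1 hi).1).2
      _ = ∑ i with ¬ c' ≤ l i, l i := by
          rw [← Finset.sum_union]
          · congr 1
            ext i
            simp only [Finset.mem_union, Finset.mem_filter, Finset.mem_univ, true_and,
              Finset.mem_sdiff]
            constructor
            · rintro (h1 | h1)
              · exact fun h2 => h1 (hc.trans h2)
              · exact h1.2
            · intro h1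
              by_cases h2 : c ≤ l i
              · exact Or.inr ⟨h2, h1⟩
              · exact Or.inl h2
          · rw [Finset.disjoint_left]
            intro i hi hi'
            exact (Finset.mem_filter.1 hi).2 (Finset.mem_filter.1 (Finset.mem_sdiff.1 hi').1).2
  have hcard : ((S \ T).card : ℝ) + T.card = S.card := by
    exact_mod_cast Finset.card_sdiff_add_card_eq_card h.1
  have hSsum : ∑ i ∈ S \ T, a i + ∑ i ∈ T, a i = ∑ i ∈ S, a i := Finset.sum_sdiff h.1
  have hall : ∑ i ∈ S, a i + ∑ i ∈ Sᶜ, a i = ∑ i, a i := Finset.sum_add_sum_compl _ _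
  have hall' : ∑ i ∈ T, a i + ∑ i ∈ Tᶜ, a i = ∑ i, a i := Finset.sum_add_sum_compl _ _
  have hkey := h.card_mul_sum_sdiff_le
  rw [hmin] at hV
  refine le_trans ?_ hC
  have hS0' : (0 : ℝ) < S.card := by exact_mod_cast hS0
  rw [← NNReal.coe_le_coe] at hV hD hkey ⊢
  rw [← NNReal.coe_inj] at hSsum hall hall'
  push_cast at hV hD hkey hSsum hall hall' ⊢
  have hT0 : (0 : ℝ) ≤ T.card := Nat.cast_nonneg _
  have hd0 : (0 : ℝ) ≤ (S \ T).card := Nat.cast_nonneg _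
  generalize ((S \ T).card : ℝ) = d at *
  generalize (S.card : ℝ) = k at *
  generalize (T.card : ℝ) = k' at *
  generalize ∑ i ∈ S \ T, (a i : ℝ) = u at *
  generalize ∑ i ∈ T, (a i : ℝ) = v at *
  generalize ∑ i ∈ S, (a i : ℝ) = w at *
  generalize ∑ i ∈ Sᶜ, (a i : ℝ) = D at *
  generalize ∑ i ∈ Tᶜ, (a i : ℝ) = D' at *
  generalize ∑ i, (a i : ℝ) = V at *
  generalize ∑ i with ¬ c ≤ l i, (l i : ℝ) = C at *
  have e : D' = D + u := by linarith
  -- After scaling by k = |S|, averaging gives k D' ≤ d V + k' D; inserting V ≤ C + k c and D ≤ C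
  -- yields D' ≤ C + d c.
  refine le_of_mul_le_mul_left ?_ hS0'
  have h1 : k * u ≤ d * (V - D) := by
    have : V - D = u + v := by linarith
    rw [this, ← hcard]
    linarith
  have h2 : d * V ≤ d * (C + k * c) := mul_le_mul_of_nonneg_left hV hd0
  have h3 : k' * D ≤ k' * C := mul_le_mul_of_nonneg_left hD hT0
  calc k * D' = k * u + k * D := by rw [e]; ring
    _ ≤ d * (V - D) + (d + k') * D := by rw [hcard]; linarith
    _ = d * V + k' * D := by ring
    _ ≤ d * (C + k * c) + k' * C := add_le_add h2 h3
    _ = (d + k') * C + k * (d * c) := by ring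
    _ = k * (C + d * c) := by rw [hcard]; ring

theorem Majorizes.trans {n : ℕ} {x y z : Vec n} (hxy : Majorizes x y) (hyz : Majorizes y z) :
    Majorizes x z :=
  ⟨hxy.1.trans hyz.1, fun j hj => (hyz.2 j hj).trans (hxy.2 j hj)⟩

theorem sum_castLE {M : Type*} [AddCommMonoid M] {t m : ℕ} (htm : t ≤ m) (F : Fin m → M) :
    ∑ r : Fin t, F (Fin.castLE htm r) = ∑ s with (s : Fin m).val < t, F s := by
  refine Finset.sum_of_injOn (Fin.castLE htm) (Fin.castLE_injective htm).injOn
    (fun r _ => by simp) (fun s hs hs' => ?_) fun _ _ => rfl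
  refine absurd ⟨⟨s, by simpa using hs⟩, by simp, ?_⟩ hs'
  rfl

/-! ### Runs of the nested adversary -/

section NestedRun

variable {n : ℕ} {K : ℕ → ℕ} {Q : ℕ → ℝ≥0}

theorem antitone_nested (hK : Antitone K) (hKn : K 0 ≤ n) {m : ℕ} {h : Fin (m + 1) → Round n}
    (hh : IsHistory (nestedNext K Q) (m + 1) h) : Antitone fun t => (h t).1.1 := by
  refine Fin.antitone_iff_succ_le.2 fun i => ?_
  have h1 := isTop_nestedNext hK hKn (i.val + 1)
    (hh.castLE (Nat.le_of_lt (Nat.succ_lt_succ i.isLt)))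
  rw [(hh i.succ).1]
  exact h1.1

theorem card_nested (hK : Antitone K) (hKn : K 0 ≤ n) {m : ℕ} {h : Fin m → Round n}
    (hh : IsHistory (nestedNext K Q) m h) (t : Fin m) : (h t).1.1.card = K t := by
  rw [(hh t).1]
  exact (isTop_nestedNext hK hKn t (hh.castLE t.isLt.le)).2.1

theorem quantity_nested {m : ℕ} {h : Fin m → Round n}
    (hh : IsHistory (nestedNext K Q) m h) (t : Fin m) : (h t).1.2 = Q t := by
  rw [(hh t).1]
  rfl

theorem sum_load_nested {m : ℕ} {h : Fin m → Round n}
    (hh : IsHistory (nestedNext K Q) m h) : ∑ i, (∑ t, (h t).2) i = ∑ t ∈ Finset.range m, Q t := by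
  rw [sum_sum_of_feasible (E := fun t => (h t).1) fun t => (hh t).2, Finset.sum_range]
  exact Finset.sum_congr rfl fun t _ => quantity_nested hh t

variable {l : Vec n} {L : ℕ → ℝ≥0}

/-- The invariant of the game, by induction on rounds with `IsTop.sum_compl_le` as the step. It
holds for every feasible history, whatever the policy. -/
theorem sum_compl_nestedNext_le (hL : Monotone L)
    (hKL : ∀ t, K t = (Finset.univ.filter fun i => L t ≤ l i).card) (hK0 : ∀ t, 0 < K t)
    (hK : Antitone K) (hKn : K 0 ≤ n) (t : ℕ)
    (hV : ∀ s < t, ∑ r ∈ Finset.range (s + 1), Q r ≤ ∑ i, min (l i) (L s))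
    {h : Fin t → Round n} (hh : IsHistory (nestedNext K Q) t h) :
    ∑ i ∈ (nestedNext K Q t h).1ᶜ, (∑ s, (h s).2) i ≤ ∑ i with ¬ L t ≤ l i, l i := by
  induction t with
  | zero => simp
  | succ t ih =>
    have hh' := hh.castLE (Nat.le_succ t)
    have hD := ih (fun s hs => hV s (hs.trans (Nat.lt_succ_self t))) hh'
    have hlast := hh (Fin.last t)
    have htop := isTop_nestedNext hK hKn (t + 1) hh
    have hcard := card_nested hK hKn hh (Fin.last t)
    rw [hKL (t + 1)] at htop
    refine htop.sum_compl_le (c := L t) (hcard.trans (hKL t)) (hcard.symm ▸ hK0 t)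
      (hL (Nat.le_succ t)) ?_ ?_
    -- Round `t` places nothing outside its own neighbourhood, so the load there is unchanged.
    · refine le_trans (le_of_eq ?_) hD
      have hset : lastSet (t + 1) h = (nestedNext K Q t fun r =>
          h (Fin.castLE (Nat.le_succ t) r)).1 := congrArg Prod.fst hlast.1
      rw [hset]
      refine Finset.sum_congr rfl fun i hi => ?_
      rw [Fin.sum_univ_castSucc, Pi.add_apply, hlast.2.1 i, add_zero]
      · rfl
      · rw [show (h (Fin.last t)).1.1 = _ from hset]
        exact Finset.mem_compl.1 hi
    · rw [sum_load_nested hh]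
      exact hV t (Nat.lt_succ_self t)

/-- Neighbourhoods are nested, so nothing is placed outside the `t`-th one from round `t` on and the
invariant persists to the end. -/
theorem sum_compl_nested_le (hL : Monotone L)
    (hKL : ∀ t, K t = (Finset.univ.filter fun i => L t ≤ l i).card) (hK0 : ∀ t, 0 < K t)
    (hK : Antitone K) (hKn : K 0 ≤ n) {m : ℕ}
    (hV : ∀ s < m + 1, ∑ r ∈ Finset.range (s + 1), Q r ≤ ∑ i, min (l i) (L s))
    {h : Fin (m + 1) → Round n} (hh : IsHistory (nestedNext K Q) (m + 1) h) (t : Fin (m + 1)) :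
    ∑ i ∈ (h t).1.1ᶜ, (∑ s, (h s).2) i ≤ ∑ i with ¬ L t ≤ l i, l i := by
  have h1 := sum_compl_nestedNext_le hL hKL hK0 hK hKn t
    (fun s hs => hV s (hs.trans t.isLt)) (hh.castLE t.isLt.le)
  have hset := congrArg Prod.fst (hh t).1
  rw [← hset, sum_castLE t.isLt.le fun s => (h s).2] at h1
  refine le_trans (le_of_eq (Finset.sum_congr rfl fun i hi => ?_)) h1
  rw [Finset.sum_apply, Finset.sum_apply]
  refine (Finset.sum_subset (Finset.subset_univ _) fun s _ hs => (hh s).2.1 i fun his => ?_).symm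
  have hts : t ≤ s := by simpa using hs
  exact Finset.mem_compl.1 hi (antitone_nested hK hKn hh hts his)

theorem majorizes_nested_load (hL : Monotone L)
    (hKL : ∀ t, K t = (Finset.univ.filter fun i => L t ≤ l i).card) (hK0 : ∀ t, 0 < K t)
    (hK : Antitone K) (hKn : K 0 ≤ n) {m : ℕ}
    (hV : ∀ s < m + 1, ∑ r ∈ Finset.range (s + 1), Q r ≤ ∑ i, min (l i) (L s))
    (hsum : ∑ i, l i = ∑ t ∈ Finset.range (m + 1), Q t)
    (hlL : ∀ i, l i ≠ 0 → ∃ t : Fin (m + 1), l i = L t)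
    {h : Fin (m + 1) → Round n} (hh : IsHistory (nestedNext K Q) (m + 1) h) :
    Majorizes (∑ t, (h t).2) l := by
  have hs : ∑ i, (∑ t, (h t).2) i = ∑ i, l i := (sum_load_nested hh).trans hsum.symm
  refine majorizes_of_level_sets hs fun c => ?_
  by_cases hc : (Finset.univ.filter fun i => c < l i).Nonempty
  · obtain ⟨i₀, hi₀, hmin⟩ := Finset.exists_min_image _ l hc
    have hci₀ : c < l i₀ := (Finset.mem_filter.1 hi₀).2
    obtain ⟨t, ht⟩ := hlL i₀ (pos_of_gt hci₀).ne'
    have hset : (Finset.univ.filter fun i => c < l i) = Finset.univ.filter fun i => L t ≤ l i := by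
      ext i
      simp only [Finset.mem_filter, Finset.mem_univ, true_and]
      refine ⟨fun hi => ht ▸ hmin i (by simpa using hi), fun hi => ?_⟩
      exact (ht ▸ hci₀ : c < L t).trans_le hi
    -- This neighbourhood has the size of {l ≥ L t}; as totals agree, the bound on its complement
    -- becomes a lower bound on its load.
    refine ⟨(h t).1.1, ?_, ?_⟩
    · rw [card_nested hK hKn hh t, hset, hKL]
    · have h1 := sum_compl_nested_le hL hKL hK0 hK hKn hV hh t
      rw [← Finset.sum_add_sum_compl (h t).1.1,
        ← Finset.sum_filter_add_sum_filter_not Finset.univ fun i => L t ≤ l i] at hs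
      rw [hset]
      by_contra! hlt
      exact (add_lt_add_of_lt_of_le hlt h1).ne hs
  · rw [Finset.not_nonempty_iff_eq_empty] at hc
    exact ⟨∅, by simp, by simp [hc]⟩

theorem majorizes_nested_optimum (hL : Monotone L)
    (hKL : ∀ t, K t = (Finset.univ.filter fun i => L t ≤ l i).card) (hK0 : ∀ t, 0 < K t)
    (hK : Antitone K) (hKn : K 0 ≤ n) {m : ℕ} {E : Fin (m + 1) → Node n}
    (σ : Equiv.Perm (Fin (m + 1))) (hE : ∀ t, (E t).1.Nonempty)
    (hQ : ∀ t : Fin (m + 1), Q t = (E (σ t)).2)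
    (hN : ∀ t : Fin (m + 1), (E (σ t)).1 ⊆ Finset.univ.filter fun i => L t ≤ l i)
    {h : Fin (m + 1) → Round n} (hh : IsHistory (nestedNext K Q) (m + 1) h) :
    Majorizes (OPT E) (OPT fun t => (h t).1) := by
  have hne : ∀ t, (h t).1.1.Nonempty := fun t => by
    rw [← Finset.card_pos, card_nested hK hKn hh]
    exact hK0 t
  obtain ⟨x, hx⟩ := exists_isBalanced (fun t => (h t).1) hne
  refine Majorizes.trans (hx.majorizes (isHindsightOptimal_OPT E hE).1 ?_ fun H => ?_)
    ((isHindsightOptimal_OPT _ hne).2 _ ⟨x, hx.1, rfl⟩)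
  · rw [← Equiv.sum_comp σ]
    exact Finset.sum_congr rfl fun t _ => by rw [quantity_nested hh, hQ]
  · by_cases hH : (Finset.univ.filter fun t => (h t).1.1 ⊆ H).Nonempty
    -- The earliest nested round confined to `H` has the lowest level, so its level set contains the
    -- original neighbourhoods of all the others.
    · obtain ⟨t₀, ht₀, hmin⟩ := Finset.exists_min_image _ id hH
      refine ⟨Finset.univ.filter fun i => L t₀ ≤ l i, ?_, ?_⟩
      · rw [← hKL, ← card_nested hK hKn hh t₀]
        exact Finset.card_le_card (Finset.mem_filter.1 ht₀).2
      · rw [Finset.sum_filter (s := Finset.univ) (p := fun t => (E t).1 ⊆ _),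
          ← Equiv.sum_comp σ, ← Finset.sum_filter]
        calc _ = ∑ t with (h t).1.1 ⊆ H, (E (σ t)).2 :=
              Finset.sum_congr rfl fun t _ => by rw [quantity_nested hh, hQ]
          _ ≤ _ := by
              refine Finset.sum_le_sum_of_subset fun t ht => ?_
              have htt : t₀ ≤ t := hmin t ht
              refine Finset.mem_filter.2 ⟨Finset.mem_univ _, (hN t).trans fun i hi => ?_⟩
              simp only [Finset.mem_filter, Finset.mem_univ, true_and] at hi ⊢
              exact (hL htt).trans hi
    · rw [Finset.not_nonempty_iff_eq_empty] at hH
      exact ⟨∅, by simp, by simp [hH]⟩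

end NestedRun

/-! ### Levels of a water-filling run -/

/-- The allocations `x` raise nodes to a common level `L t` in round `t`, and use no node that is
above that level. -/
structure IsLeveled {n m : ℕ} (E : Fin m → Node n) (x : Fin m → Vec n) (L : Fin m → ℝ≥0) :
    Prop where
  feasible : ∀ t, x t ∈ feasibleAllocations (E t)
  level_le : ∀ t, ∀ i ∈ (E t).1, L t ≤ (∑ s, x s) i
  le_level : ∀ t i, x t i ≠ 0 → ∑ s with s ≤ t, x s i ≤ L t

section Leveled

variable {n m : ℕ} {E : Fin m → Node n} {x : Fin m → Vec n} {L : Fin m → ℝ≥0}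

/-- The last round of level at most `c` that uses `i` leaves it at load at most `c`, all earlier
rounds included. -/
theorem IsLeveled.sum_le (hx : IsLeveled E x L) (c : ℝ≥0) (i : Fin n) :
    ∑ t with L t ≤ c, x t i ≤ c := by
  by_cases hne : (Finset.univ.filter fun t => L t ≤ c ∧ x t i ≠ 0).Nonempty
  · obtain ⟨t, ht, hmax⟩ := Finset.exists_max_image _ id hne
    simp only [Finset.mem_filter, Finset.mem_univ, true_and, id] at ht hmax
    refine le_trans ?_ ((hx.le_level t i ht.2).trans ht.1)
    rw [← Finset.sum_filter_ne_zero]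
    refine Finset.sum_le_sum_of_subset fun s hs => ?_
    simp only [Finset.mem_filter, Finset.mem_univ, true_and] at hs ⊢
    exact hmax s hs
  · refine (Finset.sum_eq_zero fun t ht => ?_).trans_le zero_le
    by_contra h
    exact hne ⟨t, by simpa using ⟨(Finset.mem_filter.1 ht).2, h⟩⟩

theorem IsLeveled.sum_quantity_le (hx : IsLeveled E x L) (c : ℝ≥0) :
    ∑ t with L t ≤ c, (E t).2 ≤ ∑ i, min ((∑ s, x s) i) c := by
  simp only [← (hx.feasible _).2]
  rw [Finset.sum_comm]
  refine Finset.sum_le_sum fun i _ => le_min ?_ (hx.sum_le c i)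
  rw [Finset.sum_apply]
  exact Finset.sum_le_sum_of_subset (Finset.subset_univ _)

/-- The last round that uses `i` leaves it exactly at that round's level. -/
theorem IsLeveled.exists_eq_level (hx : IsLeveled E x L) {i : Fin n} (hi : (∑ s, x s) i ≠ 0) :
    ∃ t, (∑ s, x s) i = L t := by
  have hne : (Finset.univ.filter fun t => x t i ≠ 0).Nonempty := by
    rw [Finset.sum_apply] at hi
    obtain ⟨t, _, ht⟩ := Finset.exists_ne_zero_of_sum_ne_zero hi
    exact ⟨t, by simpa using ht⟩
  obtain ⟨t, ht, hmax⟩ := Finset.exists_max_image _ id hne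
  simp only [Finset.mem_filter, Finset.mem_univ, true_and, id] at ht hmax
  have hiN : i ∈ (E t).1 := by
    by_contra h
    exact ht ((hx.feasible t).1 i h)
  refine ⟨t, le_antisymm (le_trans (le_of_eq ?_) (hx.le_level t i ht)) (hx.level_le t i hiN)⟩
  rw [Finset.sum_apply]
  refine (Finset.sum_subset (Finset.subset_univ _) fun s _ hs => ?_).symm
  by_contra h
  exact hs (by simpa using hmax s h)

end Leveled

/-- A levelled run on a static sequence is dominated by an adaptive request sequence: every history
of the latter has a less balanced load vector and a more balanced hindsight optimum. -/
theorem IsLeveled.exists_adaptiveSequence {n m : ℕ} {q : ℝ≥0} {E : Fin (m + 1) → Node n}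
    {x : Fin (m + 1) → Vec n} {L : Fin (m + 1) → ℝ≥0} (hx : IsLeveled E x L)
    (hE : ∀ t, (E t).1.Nonempty) (hpos : ∀ t, 0 < (E t).2) (hq : ∑ t, (E t).2 = q) :
    ∃ E' : AdaptiveSequence n (m + 1) q, ∀ h, IsHistory E'.next (m + 1) h →
      Majorizes (∑ t, (h t).2) (∑ t, x t) ∧ Majorizes (OPT E) (OPT fun t => (h t).1) := by
  set σ := Tuple.sort L with hσ
  set l := ∑ t, x t with hl
  -- Repeating the last round beyond `m` keeps positivity and monotonicity valid on all of `ℕ`.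
  let τ : ℕ → Fin (m + 1) := fun t => σ (Fin.clamp t m)
  have hτ : ∀ t : Fin (m + 1), τ t = σ t := fun t => by
    change σ _ = σ _
    congr 1
    ext
    simp [Fin.clamp]
    omega
  let L' : ℕ → ℝ≥0 := fun t => L (τ t)
  let Q : ℕ → ℝ≥0 := fun t => (E (τ t)).2
  let K : ℕ → ℕ := fun t => (Finset.univ.filter fun i => L' t ≤ l i).card
  have hL' : Monotone L' := fun s t hst => Tuple.monotone_sort L (by
    rw [Fin.le_def]
    exact min_le_min_right m hst)
  have hK : Antitone K := fun s t hst => Finset.card_le_card fun i hi => by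
    simp only [Finset.mem_filter, Finset.mem_univ, true_and] at hi ⊢
    exact (hL' hst).trans hi
  have hKn : K 0 ≤ n := (Finset.card_le_univ _).trans_eq (Fintype.card_fin n)
  have hN : ∀ t : ℕ, (E (τ t)).1 ⊆ Finset.univ.filter fun i => L' t ≤ l i := fun t i hi => by
    exact Finset.mem_filter.2 ⟨Finset.mem_univ i, hx.level_le (τ t) i hi⟩
  have hK0 : ∀ t, 0 < K t := fun t => Finset.card_pos.2 ((hE (τ t)).mono (hN t))
  have hQq : ∑ t ∈ Finset.range (m + 1), Q t = q := by
    rw [Finset.sum_range, ← hq, ← Equiv.sum_comp σ fun t => (E t).2]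
    exact Finset.sum_congr rfl fun t _ => by simp only [Q, hτ]
  have hV : ∀ s < m + 1, ∑ r ∈ Finset.range (s + 1), Q r ≤ ∑ i, min (l i) (L' s) := by
    intro s hs
    refine le_trans ?_ (hx.sum_quantity_le (L' s))
    rw [Finset.sum_filter, ← Equiv.sum_comp σ, ← Finset.sum_filter, Finset.sum_range]
    have h1 : ∀ r : Fin (s + 1), Q r = (E (σ (Fin.castLE hs r))).2 := fun r => by
      rw [← hτ]
      rfl
    simp only [h1]
    rw [sum_castLE (F := fun r => (E (σ r)).2)]
    refine Finset.sum_le_sum_of_subset fun r hr => ?_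
    simp only [Finset.mem_filter, Finset.mem_univ, true_and] at hr ⊢
    rw [← hτ]
    exact hL' (Nat.lt_succ_iff.1 hr)
  refine ⟨nestedAdversary K Q hK hKn hK0 (fun t => hpos _) hQq, fun h hh => ⟨?_, ?_⟩⟩
  · refine majorizes_nested_load hL' (fun t => rfl) hK0 hK hKn hV ?_ (fun i hi => ?_) hh
    · rw [hl, sum_sum_of_feasible hx.feasible, hq, hQq]
    · obtain ⟨t, ht⟩ := hx.exists_eq_level hi
      refine ⟨σ.symm t, ht.trans ?_⟩
      simp only [L', hτ, Equiv.apply_symm_apply]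
  · refine majorizes_nested_optimum hL' (fun t => rfl) hK0 hK hKn σ hE (fun t => ?_)
      (fun t => ?_) hh
    · simp only [Q, hτ]
    · rw [← hτ]
      exact hN t

/-! ### The game -/

section Game

variable {n m : ℕ} {q : ℝ≥0}

theorem play_spec (A : Policy.{u} n) (E : AdaptiveSequence n m q) (ω : A.Ω) (t : ℕ) (s : Fin t) :
    (play A E ω t s).1 = E.next s (fun r => play A E ω t (Fin.castLE s.isLt.le r)) ∧
      (play A E ω t s).2 = A.act ω s (fun r => play A E ω t (Fin.castLE s.isLt.le r))
        (play A E ω t s).1 := by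
  induction t with
  | zero => exact s.elim0
  | succ t ih =>
    have hcast : ∀ r : Fin t, play A E ω (t + 1) r.castSucc = play A E ω t r := fun r => by
      simp only [play, Fin.snoc_castSucc]
    refine Fin.lastCases ?_ (fun s => ?_) s
    · have hpre : (fun r : Fin t => play A E ω (t + 1) (Fin.castLE (Nat.le_succ t) r)) =
          play A E ω t := funext hcast
      have hlast : play A E ω (t + 1) (Fin.last t) = (E.next t (play A E ω t),
          A.act ω t (play A E ω t) (E.next t (play A E ω t))) := by
        simp only [play, Fin.snoc_last]
      change _ = E.next t (fun r : Fin t => play A E ω (t + 1) (Fin.castLE (Nat.le_succ t) r)) ∧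
        _ = A.act ω t (fun r : Fin t => play A E ω (t + 1) (Fin.castLE (Nat.le_succ t) r)) _
      rw [hpre, hlast]
      exact ⟨rfl, rfl⟩
    · have hpre : (fun r : Fin s => play A E ω (t + 1)
          (Fin.castLE (Nat.le_succ_of_le s.isLt.le) r)) =
          fun r : Fin s => play A E ω t (Fin.castLE s.isLt.le r) :=
        funext fun r => hcast (Fin.castLE s.isLt.le r)
      change _ = E.next s (fun r : Fin s => play A E ω (t + 1)
          (Fin.castLE (Nat.le_succ_of_le s.isLt.le) r)) ∧
        _ = A.act ω s (fun r : Fin s => play A E ω (t + 1)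
          (Fin.castLE (Nat.le_succ_of_le s.isLt.le) r)) _
      rw [hpre, hcast]
      exact ih s

/-- Non-empty neighbourhoods, hence feasible actions, are only guaranteed in the first `m` rounds;
both are established together by induction on prefixes. -/
theorem isHistory_play (A : Policy.{u} n) (E : AdaptiveSequence n m q) (ω : A.Ω) (t : ℕ)
    (ht : t ≤ m) : IsHistory E.next t (play A E ω t) := by
  suffices h : ∀ k (hk : k ≤ t),
      IsHistory E.next k fun r => play A E ω t (Fin.castLE hk r) from h t le_rfl
  intro k
  induction k with
  | zero => exact fun _ s => s.elim0
  | succ k ih =>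
    intro hk
    refine Fin.lastCases ?_ fun s => ih (Nat.le_of_succ_le hk) s
    obtain ⟨h1, h2⟩ := play_spec A E ω t (Fin.castLE hk (Fin.last k))
    refine ⟨h1, ?_⟩
    rw [h2]
    refine A.act_feasible ω _ _ _ ?_
    rw [h1]
    exact E.neighbourhood_nonempty k (by omega) _ (ih (Nat.le_of_succ_le hk))

theorem IsHistory.nonempty {E : AdaptiveSequence n m q} {h : Fin m → Round n}
    (hh : IsHistory E.next m h) (t : Fin m) : (h t).1.1.Nonempty := by
  rw [(hh t).1]
  exact E.neighbourhood_nonempty t t.isLt _ (hh.castLE t.isLt.le)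

theorem IsHistory.pos {E : AdaptiveSequence n m q} {h : Fin m → Round n}
    (hh : IsHistory E.next m h) (t : Fin m) : 0 < (h t).1.2 := by
  rw [(hh t).1]
  exact E.quantity_pos t t.isLt _ (hh.castLE t.isLt.le)

/-- By `IsWaterFilling.eq_level`, a round raises its neighbours to at least the water level, exactly
to it where something is added; loads never decrease afterwards. -/
theorem exists_isLeveled_WF (E : AdaptiveSequence n m q) (ω : (WF n).Ω) :
    ∃ L, IsLeveled (requests (WF n) E ω) (fun t => (play (WF n) E ω m t).2) L := by
  have hh := isHistory_play (WF n) E ω m le_rfl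
  have hlev : ∀ t : Fin m, ∃ c : ℝ≥0, ∀ i ∈ (play (WF n) E ω m t).1.1,
      (play (WF n) E ω m t).2 i = c - ∑ s with s < t, (play (WF n) E ω m s).2 i := by
    intro t
    have h1 := isWaterFilling_waterFill (play (WF n) E ω m t).1
      (∑ r : Fin t, (play (WF n) E ω m (Fin.castLE t.isLt.le r)).2) (hh.nonempty t)
    have h2 : (play (WF n) E ω m t).2 = waterFill _ _ := (play_spec (WF n) E ω m t).2
    rw [← h2] at h1
    refine ⟨(play (WF n) E ω m t).1.1.inf' (hh.nonempty t) fun i => (play (WF n) E ω m t).2 i +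
      (∑ r : Fin t, (play (WF n) E ω m (Fin.castLE t.isLt.le r)).2) i,
      fun i hi => ((h1.eq_level (hh.nonempty t)).2 i hi).trans ?_⟩
    congr 1
    rw [sum_castLE t.isLt.le fun s => (play (WF n) E ω m s).2, Finset.sum_apply]
    rfl
  choose L hL using hlev
  have hsplit : ∀ (t : Fin m) (i : Fin n), ∑ s with s ≤ t, (play (WF n) E ω m s).2 i =
      (play (WF n) E ω m t).2 i + ∑ s with s < t, (play (WF n) E ω m s).2 i := by
    intro t i
    rw [← Finset.sum_insert (f := fun s => (play (WF n) E ω m s).2 i) (by simp)]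
    congr 1
    ext s
    simp [le_iff_eq_or_lt]
  refine ⟨L, fun t => (hh t).2, fun t i hi => ?_, fun t i hi => ?_⟩
  · rw [Finset.sum_apply]
    refine le_trans ?_ (Finset.sum_le_sum_of_subset (Finset.subset_univ
      (Finset.univ.filter fun s => s ≤ t)))
    rw [hsplit, hL t i hi]
    exact le_tsub_add
  · have hiN : i ∈ (play (WF n) E ω m t).1.1 := by
      by_contra h
      exact hi ((hh t).2.1 i h)
    rw [hsplit]
    rw [hL t i hiN] at hi ⊢
    exact (tsub_add_cancel_of_le (tsub_pos_iff_lt.1 (pos_iff_ne_zero.2 hi)).le).le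

/-- Against every policy, some adaptive request sequence leads to less balanced loads and more
balanced hindsight optima than `E` does against water-filling. -/
theorem exists_dominating_adaptiveSequence (hq : 0 < q) (A : Policy.{u} n)
    (E : AdaptiveSequence n m q) (ω₀ : (WF n).Ω) :
    ∃ E' : AdaptiveSequence n m q, ∀ ω,
      Majorizes (load A E' ω) (load (WF n) E ω₀) ∧
        Majorizes (OPT (requests (WF n) E ω₀)) (OPT (requests A E' ω)) := by
  have hh := isHistory_play (WF n) E ω₀ m le_rfl
  have hsum := E.total_quantity _ hh
  obtain _ | m := m
  -- With no rounds the total quantity would be 0.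
  · exact absurd hsum (by simpa using hq.ne)
  obtain ⟨L, hL⟩ := exists_isLeveled_WF E ω₀
  obtain ⟨E', hE'⟩ := hL.exists_adaptiveSequence hh.nonempty hh.pos hsum
  exact ⟨E', fun ω => hE' _ (isHistory_play A E' ω (m + 1) le_rfl)⟩

theorem sum_load (A : Policy.{u} n) (E : AdaptiveSequence n m q) (ω : A.Ω) :
    ∑ i, load A E ω i = q := by
  have hh := isHistory_play A E ω m le_rfl
  exact (sum_sum_of_feasible (E := requests A E ω) fun t => (hh t).2).trans
    (E.total_quantity _ hh)

theorem sum_OPT (A : Policy.{u} n) (E : AdaptiveSequence n m q) (ω : A.Ω) :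
    ∑ i, OPT (requests A E ω) i = q := by
  have hh := isHistory_play A E ω m le_rfl
  exact (sum_of_mem_feasibleLoads (isHindsightOptimal_OPT _ hh.nonempty).1).trans
    (E.total_quantity _ hh)

end Game

/-- The upper bound only secures integrability; without it the integral could be the default 0. -/
theorem le_integral_of_forall_mem_Icc {Ω : Type*} [MeasurableSpace Ω] {μ : Measure Ω}
    [IsProbabilityMeasure μ] {X : Ω → ℝ} (hX : AEMeasurable X μ) {a b : ℝ}
    (h : ∀ ω, X ω ∈ Set.Icc a b) : a ≤ ∫ ω, X ω ∂μ := by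
  have hint : Integrable X μ := Integrable.of_mem_Icc a b hX (ae_of_all _ h)
  calc a = ∫ _, a ∂μ := by simp
    _ ≤ ∫ ω, X ω ∂μ := integral_mono (integrable_const a) hint fun ω => (h ω).1

end WaterFilling

theorem mainTheorem8 (n m : ℕ) (q : ℝ≥0) (hq : 0 < q) (α : ℝ) (hα : 0 ≤ α)
    (A : WaterFilling.Policy.{u} n) :
    (∀ f : WaterFilling.Vec n → ℝ≥0, WaterFilling.SchurConcave f →
      (∀ E : WaterFilling.AdaptiveSequence n m q,
        AEMeasurable (WaterFilling.lossMax α f A E) A.P) →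
      WaterFilling.regretMax m q α f (WaterFilling.WF n) ≤
        WaterFilling.regretMax m q α f A) ∧
    (∀ g : WaterFilling.Vec n → ℝ≥0, WaterFilling.SchurConvex g →
      (∀ E : WaterFilling.AdaptiveSequence n m q,
        AEMeasurable (WaterFilling.lossMin α g A E) A.P) →
      WaterFilling.regretMin m q α g (WaterFilling.WF n) ≤
        WaterFilling.regretMin m q α g A) := by
  open WaterFilling in
  refine ⟨fun f hf hmeas => iSup_le fun E => ?_, fun g hg hmeas => iSup_le fun E => ?_⟩
  · obtain ⟨E', hE'⟩ := exists_dominating_adaptiveSequence hq A E ()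
    refine le_trans (EReal.coe_le_coe_iff.2 ?_) (le_iSup (fun E => (costMax α f A E : EReal)) E')
    have hWF : costMax α f (WF n) E = lossMax α f (WF n) E () :=
      integral_dirac (α := Unit) (lossMax α f (WF n) E) ()
    rw [hWF]
    refine le_integral_of_forall_mem_Icc (b := α * f fun _ => q / n) (hmeas E') fun ω => ⟨?_, ?_⟩
    · have h1 : (f (load A E' ω) : ℝ) ≤ f (load (WF n) E ()) := hf _ _ (hE' ω).1
      have h2 : (f (OPT (requests (WF n) E ())) : ℝ) ≤ f (OPT (requests A E' ω)) :=
        hf _ _ (hE' ω).2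
      exact sub_le_sub (mul_le_mul_of_nonneg_left h2 hα) h1
    · have h1 := majorizes_const (OPT (requests A E' ω))
      rw [sum_OPT] at h1
      have h2 : (f (OPT (requests A E' ω)) : ℝ) ≤ f fun _ => q / n := hf _ _ h1
      exact (sub_le_self _ (NNReal.coe_nonneg _)).trans (mul_le_mul_of_nonneg_left h2 hα)
  · obtain ⟨E', hE'⟩ := exists_dominating_adaptiveSequence hq A E ()
    refine le_trans (EReal.coe_le_coe_iff.2 ?_) (le_iSup (fun E => (costMin α g A E : EReal)) E')
    have hWF : costMin α g (WF n) E = lossMin α g (WF n) E () :=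
      integral_dirac (α := Unit) (lossMin α g (WF n) E) ()
    rw [hWF]
    have hn : ∀ ω, ∃ i₀ : Fin n, (g (load A E' ω) : ℝ) ≤ g (Pi.single i₀ q) := fun ω => by
      have hs := sum_load A E' ω
      obtain ⟨i₀, -, -⟩ := Finset.exists_ne_zero_of_sum_ne_zero (hs.trans_ne hq.ne')
      have h1 := majorizes_single (load A E' ω) i₀
      rw [hs] at h1
      exact ⟨i₀, hg _ _ h1⟩
    -- Summing over all `i₀` gives a bound that does not depend on the node chosen for each `ω`.
    refine le_integral_of_forall_mem_Icc (b := ∑ i₀, (g (Pi.single i₀ q) : ℝ)) (hmeas E')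
      fun ω => ⟨?_, ?_⟩
    · have h1 : (g (load (WF n) E ()) : ℝ) ≤ g (load A E' ω) := hg _ _ (hE' ω).1
      have h2 : (g (OPT (requests A E' ω)) : ℝ) ≤ g (OPT (requests (WF n) E ())) :=
        hg _ _ (hE' ω).2
      exact sub_le_sub h1 (mul_le_mul_of_nonneg_left h2 hα)
    · obtain ⟨i₀, hi₀⟩ := hn ω
      refine (sub_le_self _ (mul_nonneg hα (NNReal.coe_nonneg _))).trans (hi₀.trans ?_)
      exact Finset.single_le_sum (f := fun i₀ => (g (Pi.single i₀ q) : ℝ))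
        (fun i _ => NNReal.coe_nonneg _) (Finset.mem_univ i₀)
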